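/- Let $\Delta>0$ be fixed, let $p_n\ge 2$ ($n\ge2$) be integers, and let $(s_n)$ be real numbers with $s_n\to\infty$ and $s_n=o(\sqrt{p_n}+\sqrt n)$. Put $T_n=\sqrt{p_n}+\sqrt n+s_n$. For each sample size $n\ge 2$ consider the Gaussian mixture model with $K=2$ components and centres $$\mu_1=c+v,\qquad \mu_2=c-v,\qquad c=t_n v,\qquad v=v_n\in\mathbb R^{p_n},\quad \|v\|=\Delta/2,$$ so that $\|\mu_1-\mu_2\|=\Delta$: the observations $1,\dots,n$ are divided into two clusters of sizes $n_1,n_2\ge1$, $n_1+n_2=n$, and the data matrix is $X=P+E\in\mathbb R^{p_n\times n}$, where the $i$-th column of $P$ is the centre of the cluster of observation $i$ and $E$ has i.i.d. $\mathcal N(0,1)$ entries. Let $\sigma_1(X)\ge\sigma_2(X)\ge\dots\ge\sigma_{\min(p_n,n)}(X)$ be the singular values of $X$ and let $\widehat K_{\rm raw}=\#\{i:\sigma_i(X)>T_n\}$ be the uncentered estimator. Then there are thresholds $\tau_n$, depending only on $\Delta$ and the sequences $(p_n)$ and $(s_n)$, and bounded in $n$ if $p_n=O(n)$, such that whenever $t_n\ge\tau_n$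 for all large $n$ (for any choice of the vectors $v_n$ and of the clusters), $$\mathbb P\bigl(\widehat K_{\rm raw}=1\bigr)\longrightarrow 1\qquad(n\to\infty),$$ while $K=2$. In particular, if $p_n=O(n)$, this holds for every sufficiently large fixed $t$. Consequently $\mathbb P(\widehat K_{\rm raw}=2)\not\to1$, i.e. the uncentered estimator is not consistent, although the separation $\Delta$ is fixed and positive. -/

import Mathlib

open Filter Topology MeasureTheory ProbabilityTheory Asymptotics

noncomputable section

/-- The `p × K` matrix whose columns are the component centres. -/
def centreMatrix {p K : ℕ} (μ : Fin K → EuclideanSpace ℝ (Fin p)) : Matrix (Fin p) (Fin K) ℝ :=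
  Matrix.of fun a k => μ k a

/-- The `n × K` membership matrix: entry `(i, k)` is `1` if observation `i` belongs to
cluster `k`, and `0` otherwise. -/
def membershipMatrix {n K : ℕ} (z : Fin n → Fin K) : Matrix (Fin n) (Fin K) ℝ :=
  Matrix.of fun i k => if z i = k then 1 else 0

/-- The signal matrix `P = M Zᵀ`; its `i`-th column is the centre of the cluster of
observation `i`. -/
def signalMatrix {p n K : ℕ} (μ : Fin K → EuclideanSpace ℝ (Fin p)) (z : Fin n → Fin K) :
    Matrix (Fin p) (Fin n) ℝ :=
  centreMatrix μ * (membershipMatrix z).transpose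

/-- The two collinear centres `c + v` and `c - v` with `c = t v`. -/
def collinearCentres {p : ℕ} (t : ℝ) (v : EuclideanSpace ℝ (Fin p)) :
    Fin 2 → EuclideanSpace ℝ (Fin p) :=
  ![t • v + v, t • v - v]

/-- A random `p × n` matrix with i.i.d. standard normal entries. -/
def IsStdGaussianMatrix {p n : ℕ} {Ω : Type*} [MeasurableSpace Ω]
    (E : Ω → Matrix (Fin p) (Fin n) ℝ) (P : Measure Ω) : Prop :=
  (∀ a i, HasLaw (fun ω => E ω a i) (gaussianReal 0 1) P) ∧
    iIndepFun (fun (e : Fin p × Fin n) (ω : Ω) => E ω e.1 e.2) P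

/-- The singular values of a real `p × n` matrix in decreasing order, with multiplicity,
numbered from `0` (so `matrixSingularValue X 0` is the largest one): those of the linear map
`ℝⁿ → ℝᵖ` between Euclidean spaces given by the matrix. -/
def matrixSingularValue {p n : ℕ} (X : Matrix (Fin p) (Fin n) ℝ) (i : ℕ) : ℝ :=
  (Matrix.toEuclideanLin X).singularValues i

/-- The threshold `√p + √n + s`. -/
def svThreshold (p n : ℕ) (s : ℝ) : ℝ := √(p : ℝ) + √(n : ℝ) + s

/-- The uncentered estimator: how many of the `min(p, n)` singular values of the raw data
matrix exceed the threshold `T`. -/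
def rawEstimator {p n : ℕ} (T : ℝ) (X : Matrix (Fin p) (Fin n) ℝ) : ℕ :=
  ((Finset.range (min p n)).filter fun i => T < matrixSingularValue X i).card

/-- Consistency of a sequence of estimators of the number of components: the probability of
returning the true value `K` tends to one. -/
def IsConsistentFor {Ω : ℕ → Type*} [∀ n, MeasurableSpace (Ω n)] (P : ∀ n, Measure (Ω n))
    (Khat : ∀ n, Ω n → ℕ) (K : ℕ) : Prop :=
  Tendsto (fun n => P n {ω | Khat n ω = K}) atTop (𝓝 1)

end

/-! Both centres lie on the line through `v`, so the signal is the rank-one matrix `v wᵀ`, where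
every entry of `w` is `t + 1` or `t - 1`. If the noise has operator norm at most `T`, then on the
hyperplane orthogonal to `w` the data matrix acts as the noise alone, so the second singular value
is at most `T`; testing on `w` shows that the first exceeds `T` once `‖v‖‖w‖ > 2T`. Since `‖w‖ ≥ (t
- 1)√n`, a value of `t` of order `T / (Δ√n)` suffices (`rawEstimator_signal_add_noise_eq_one`).

It remains to bound the norm of a Gaussian matrix by `√p + √n + s` with probability tending to one
(`IsStdGaussianMatrix.measure_norm_gt_le`). The process `uᵀEv + γ`, with an extra independent normal
`γ`, is compared with `g·u + h·v`, whose supremum is at most `‖g‖ + ‖h‖`. Chebyshev controls these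
norms with a bound free of the dimension. The comparison is Slepian's inequality, obtained by
Kahane's interpolation and Gaussian integration by parts. -/

/-! ### Variational bounds for the first two singular values. -/

section SingularValues

variable {V W : Type*} [NormedAddCommGroup V] [InnerProductSpace ℝ V] [FiniteDimensional ℝ V]
  [NormedAddCommGroup W] [InnerProductSpace ℝ W] [FiniteDimensional ℝ W]

theorem LinearMap.norm_sq_apply_eq_sum_singularValues (T : V →ₗ[ℝ] W) {n : ℕ}
    (hn : Module.finrank ℝ V = n) (x : V) :
    ‖T x‖ ^ 2 = ∑ i : Fin n, T.singularValues i ^ 2 *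
      inner ℝ (T.isSymmetric_adjoint_comp_self.eigenvectorBasis hn i) x ^ 2 := by
  set b := T.isSymmetric_adjoint_comp_self.eigenvectorBasis hn
  rw [← real_inner_self_eq_norm_sq, ← LinearMap.adjoint_inner_left, ← LinearMap.comp_apply,
    ← b.sum_inner_mul_inner]
  refine Finset.sum_congr rfl fun i _ => ?_
  rw [T.isSymmetric_adjoint_comp_self x (b i), LinearMap.IsSymmetric.apply_eigenvectorBasis,
    real_inner_smul_right, T.sq_singularValues_fin hn, real_inner_comm]
  change T.isSymmetric_adjoint_comp_self.eigenvalues hn i * inner ℝ (b i) x * _ = _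
  ring

theorem LinearMap.norm_apply_le_singularValues_zero (T : V →ₗ[ℝ] W) (x : V) :
    ‖T x‖ ≤ T.singularValues 0 * ‖x‖ := by
  have h0 := T.singularValues_nonneg 0
  refine le_of_sq_le_sq ?_ (by positivity)
  rw [T.norm_sq_apply_eq_sum_singularValues rfl, mul_pow,
    ← (T.isSymmetric_adjoint_comp_self.eigenvectorBasis rfl).sum_sq_inner_right x, Finset.mul_sum]
  gcongr with i
  exact T.singularValues_nonneg _
  exact T.singularValues_antitone (Nat.zero_le _)

/-- If `T` is bounded by `M` on the kernel of a functional, its second singular value is at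
most `M`. -/
theorem LinearMap.singularValues_one_le (T : V →ₗ[ℝ] W) (f : V →ₗ[ℝ] ℝ) {M : ℝ} (hM : 0 ≤ M)
    (h : ∀ x, f x = 0 → ‖T x‖ ≤ M * ‖x‖) : T.singularValues 1 ≤ M := by
  rcases le_or_gt (Module.finrank ℝ V) 1 with hV | hV
  · rw [T.singularValues_of_finrank_le hV]; exact hM
  set b := T.isSymmetric_adjoint_comp_self.eigenvectorBasis rfl with hb
  let i0 : Fin (Module.finrank ℝ V) := ⟨0, by omega⟩
  let i1 : Fin (Module.finrank ℝ V) := ⟨1, hV⟩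
  have hne : i0 ≠ i1 := by simp [i0, i1]
  -- As in Courant–Fischer: the span of the top two right singular vectors is a plane, so it meets
  -- the kernel of `f` nontrivially.
  obtain ⟨c, d, hcd, hf⟩ : ∃ c d : ℝ, 0 < c ^ 2 + d ^ 2 ∧ c * f (b i0) + d * f (b i1) = 0 := by
    by_cases h1 : f (b i1) = 0
    · exact ⟨0, 1, by norm_num, by simp [h1]⟩
    · exact ⟨f (b i1), - f (b i0), by positivity, by ring⟩
  have key := h (c • b i0 + d • b i1) (by simpa using hf)
  have hin : ∀ i, inner ℝ (b i) (c • b i0 + d • b i1) =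
      (if i = i0 then c else 0) + if i = i1 then d else 0 := by
    intro i
    rw [inner_add_right, real_inner_smul_right, real_inner_smul_right,
      b.inner_eq_ite, b.inner_eq_ite]
    split_ifs <;> simp
  have hx : ‖c • b i0 + d • b i1‖ ^ 2 = c ^ 2 + d ^ 2 := by
    rw [← b.sum_sq_inner_right]
    simp_rw [hin]
    rw [Finset.sum_eq_add i0 i1 hne]
    · simp [hne, hne.symm]
    · rintro i - ⟨h0, h1⟩; simp [h0, h1]
    · simp
    · simp
  have hT : T.singularValues 1 ^ 2 * (c ^ 2 + d ^ 2) ≤ ‖T (c • b i0 + d • b i1)‖ ^ 2 := by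
    rw [T.norm_sq_apply_eq_sum_singularValues rfl, ← hx, ← b.sum_sq_inner_right, Finset.mul_sum]
    refine Finset.sum_le_sum fun i _ => ?_
    rcases le_or_gt (i : ℕ) 1 with hi | hi
    · gcongr
      · exact T.singularValues_nonneg _
      · exact T.singularValues_antitone hi
    · have e0 : i ≠ i0 := by rintro rfl; simp [i0] at hi
      have e1 : i ≠ i1 := by rintro rfl; simp [i1] at hi
      rw [← hb, hin]
      simp [e0, e1]
  have h2 : ‖T (c • b i0 + d • b i1)‖ ^ 2 ≤ M ^ 2 * (c ^ 2 + d ^ 2) := by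
    rw [← hx, ← mul_pow]
    gcongr
  exact le_of_sq_le_sq (le_of_mul_le_mul_right (hT.trans h2) hcd) hM

end SingularValues

/-! ### Rank-one signal plus bounded noise. -/

theorem rawEstimator_eq_one {p n : ℕ} (hp : 2 ≤ p) (hn : 2 ≤ n) {T : ℝ}
    {X : Matrix (Fin p) (Fin n) ℝ} (h0 : T < matrixSingularValue X 0)
    (h1 : matrixSingularValue X 1 ≤ T) : rawEstimator T X = 1 := by
  have : ((Finset.range (min p n)).filter fun i => T < matrixSingularValue X i) = {0} := by
    ext i
    simp only [Finset.mem_filter, Finset.mem_range, Finset.mem_singleton]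
    constructor
    · rintro ⟨-, hi⟩
      by_contra hne
      have : matrixSingularValue X i ≤ matrixSingularValue X 1 :=
        LinearMap.singularValues_antitone _ (Nat.one_le_iff_ne_zero.2 hne)
      linarith
    · rintro rfl
      exact ⟨by omega, h0⟩
  rw [rawEstimator, this, Finset.card_singleton]

/-- The coefficient by which the direction `v` is multiplied in column `i` of the signal. -/
def signalCoeff {n : ℕ} (t : ℝ) (z : Fin n → Fin 2) : EuclideanSpace ℝ (Fin n) :=
  WithLp.toLp 2 fun i => if z i = 0 then t + 1 else t - 1

/-- Collinearity of the centres with the origin is what makes the rank one instead of two. -/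
theorem toEuclideanLin_signalMatrix_apply {p n : ℕ} (t : ℝ) (v : EuclideanSpace ℝ (Fin p))
    (z : Fin n → Fin 2) (x : EuclideanSpace ℝ (Fin n)) :
    Matrix.toEuclideanLin (signalMatrix (collinearCentres t v) z) x =
      inner ℝ (signalCoeff t z) x • v := by
  ext a
  have hP : ∀ i, signalMatrix (collinearCentres t v) z a i = signalCoeff t z i * v a := by
    intro i
    simp only [signalMatrix, centreMatrix, membershipMatrix, collinearCentres, Matrix.mul_apply,
      Fin.sum_univ_two, Matrix.transpose_apply, Matrix.of_apply, signalCoeff]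
    rcases Fin.exists_fin_two.1 ⟨z i, rfl⟩ with h | h <;> simp [h] <;> ring
  simp only [Matrix.toLpLin_apply, Matrix.mulVec, dotProduct, hP, PiLp.smul_apply, smul_eq_mul,
    PiLp.inner_apply, RCLike.inner_apply, conj_trivial, Finset.sum_mul]
  exact Finset.sum_congr rfl fun i _ => by ring

theorem mul_sqrt_le_norm_signalCoeff {n : ℕ} {t : ℝ} (ht : 1 ≤ t) (z : Fin n → Fin 2) :
    (t - 1) * √n ≤ ‖signalCoeff t z‖ := by
  rw [EuclideanSpace.norm_eq]
  refine Real.le_sqrt_of_sq_le ?_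
  rw [mul_pow, Real.sq_sqrt (Nat.cast_nonneg n)]
  calc (t - 1) ^ 2 * n = ∑ _i : Fin n, (t - 1) ^ 2 := by simp; ring
    _ ≤ _ := by
      refine Finset.sum_le_sum fun i _ => ?_
      simp only [signalCoeff, Real.norm_eq_abs, sq_abs]
      split_ifs <;> nlinarith

/-- When the noise has operator norm at most `T` and the signal exceeds `2 T`, exactly one
singular value exceeds `T`. -/
theorem rawEstimator_signal_add_noise_eq_one {p n : ℕ} (hp : 2 ≤ p) (hn : 2 ≤ n) {T t : ℝ}
    (hT : 0 ≤ T) (ht : 1 ≤ t) (v : EuclideanSpace ℝ (Fin p)) (z : Fin n → Fin 2)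
    (hv : 2 * T < ‖v‖ * ((t - 1) * √n)) {N : Matrix (Fin p) (Fin n) ℝ}
    (hN : ∀ x, ‖Matrix.toEuclideanLin N x‖ ≤ T * ‖x‖) :
    rawEstimator T (signalMatrix (collinearCentres t v) z + N) = 1 := by
  set w := signalCoeff t z with hw
  have hX : ∀ x, Matrix.toEuclideanLin (signalMatrix (collinearCentres t v) z + N) x =
      inner ℝ w x • v + Matrix.toEuclideanLin N x := fun x => by
    rw [map_add, LinearMap.add_apply, toEuclideanLin_signalMatrix_apply]
  refine rawEstimator_eq_one hp hn ?_ ?_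
  · have hlow : 2 * T < ‖v‖ * ‖w‖ :=
      hv.trans_le (by gcongr; exact mul_sqrt_le_norm_signalCoeff ht z)
    have hwpos : 0 < ‖w‖ := by
      by_contra h
      have : ‖w‖ = 0 := le_antisymm (not_lt.1 h) (norm_nonneg _)
      rw [this] at hlow; linarith
    have h1 := LinearMap.norm_apply_le_singularValues_zero
      (Matrix.toEuclideanLin (signalMatrix (collinearCentres t v) z + N)) w
    rw [hX] at h1
    have h2 : ‖inner ℝ w w • v‖ = ‖w‖ ^ 2 * ‖v‖ := by
      rw [norm_smul, real_inner_self_eq_norm_sq]; simp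
    have h3 := norm_sub_le_norm_add (inner ℝ w w • v) (Matrix.toEuclideanLin N w)
    have h4 := hN w
    -- Evaluation at `w` gives `σ₁‖w‖ ≥ ‖w‖²‖v‖ - T‖w‖ > T‖w‖`.
    refine lt_of_mul_lt_mul_right (a := ‖w‖) ?_ hwpos.le
    unfold matrixSingularValue
    refine lt_of_lt_of_le ?_ h1
    nlinarith
  · refine LinearMap.singularValues_one_le _ (innerₛₗ ℝ w) hT fun x hx => ?_
    have hx' : inner ℝ w x = (0 : ℝ) := hx
    rw [hX, hx', zero_smul, zero_add]
    exact hN x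

/-! ### Stein's identity in one and several variables. -/

section GaussianIntegrationByParts

theorem hasDerivAt_gaussianPDFReal_zero_one (x : ℝ) :
    HasDerivAt (gaussianPDFReal 0 1) (-(x * gaussianPDFReal 0 1 x)) x := by
  have h : HasDerivAt (fun x : ℝ => -(x - 0) ^ 2 / (2 * ((1 : NNReal) : ℝ))) (-x) x := by
    have := (((hasDerivAt_id x).sub_const 0).pow 2).neg.div_const (2 * ((1 : NNReal) : ℝ))
    convert! this using 1
    simp only [NNReal.coe_one, id]
    norm_num
    ring
  rw [gaussianPDFReal_def]
  convert! h.exp.const_mul (√(2 * Real.pi * ((1 : NNReal) : ℝ)))⁻¹ using 1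
  ring

theorem integrable_id_gaussianReal : Integrable (fun x : ℝ => x) (gaussianReal 0 1) :=
  (memLp_id_gaussianReal 1).integrable le_rfl

/-- Stein's identity for the standard normal distribution. -/
theorem integral_id_mul_gaussianReal {g g' : ℝ → ℝ} (hg : ∀ x, HasDerivAt g (g' x) x)
    (hg' : Measurable g') {C : ℝ} (hC : ∀ x, |g x| ≤ C) (hC' : ∀ x, |g' x| ≤ C) :
    ∫ x, x * g x ∂gaussianReal 0 1 = ∫ x, g' x ∂gaussianReal 0 1 := by
  have hgc : Continuous g := continuous_iff_continuousAt.2 fun x => (hg x).continuousAt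
  have hint : Integrable (gaussianPDFReal 0 1) := integrable_gaussianPDFReal 0 1
  have hxint : Integrable fun x => x * gaussianPDFReal 0 1 x := by
    have := integrable_id_gaussianReal
    rw [gaussianReal_of_var_ne_zero 0 one_ne_zero, integrable_withDensity_iff
      (measurable_gaussianPDF _ _) (ae_of_all _ fun _ => gaussianPDF_lt_top)] at this
    simpa only [toReal_gaussianPDF] using this
  rw [integral_gaussianReal_eq_integral_smul one_ne_zero,
    integral_gaussianReal_eq_integral_smul one_ne_zero]
  have key := integral_mul_deriv_eq_deriv_mul_of_integrable (u := g) (u' := g')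
    (v := gaussianPDFReal 0 1) (v' := fun x => -(x * gaussianPDFReal 0 1 x))
    (fun x _ => hg x) (fun x _ => hasDerivAt_gaussianPDFReal_zero_one x)
    (hxint.neg.bdd_mul hgc.aestronglyMeasurable (ae_of_all _ hC))
    (hint.bdd_mul hg'.aestronglyMeasurable (ae_of_all _ hC'))
    (hint.bdd_mul hgc.aestronglyMeasurable (ae_of_all _ hC))
  simp only [mul_neg, integral_neg, neg_inj] at key
  calc _ = ∫ x, g x * (x * gaussianPDFReal 0 1 x) := by
        congr 1; ext x; simp only [smul_eq_mul]; ring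
    _ = _ := key
    _ = _ := by congr 1; ext x; simp only [smul_eq_mul]; ring

variable {ι : Type*} [Fintype ι]

/-- The standard Gaussian measure on `ι → ℝ`. -/
noncomputable abbrev gaussianPi (ι : Type*) [Fintype ι] : Measure (ι → ℝ) :=
  Measure.pi fun _ => gaussianReal 0 1

/-- Resampling one coordinate independently keeps the product law. This gives Fubini in that
coordinate without splitting the index type. -/
theorem measurePreserving_update [DecidableEq ι] (μ : Measure ℝ) [IsProbabilityMeasure μ] (i : ι) :
    MeasurePreserving (fun q : ℝ × (ι → ℝ) => Function.update q.2 i q.1)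
      (μ.prod (Measure.pi fun _ => μ)) (Measure.pi fun _ => μ) := by
  have hm : Measurable fun q : ℝ × (ι → ℝ) => Function.update q.2 i q.1 := by
    refine measurable_pi_iff.2 fun j => ?_
    by_cases h : j = i
    · subst h; simpa using measurable_fst
    · simp only [Function.update_of_ne h]; fun_prop
  refine ⟨hm, (Measure.pi_eq fun s hs => ?_).symm⟩
  rw [Measure.map_apply hm (MeasurableSet.univ_pi hs)]
  have : (fun q : ℝ × (ι → ℝ) => Function.update q.2 i q.1) ⁻¹' Set.univ.pi s =
      s i ×ˢ Set.univ.pi (Function.update s i Set.univ) := by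
    ext q
    simp only [Set.mem_preimage, Set.mem_univ_pi, Set.mem_prod]
    constructor
    · intro h
      refine ⟨by simpa using h i, fun j => ?_⟩
      by_cases hj : j = i
      · subst hj; simp
      · simpa [hj] using h j
    · rintro ⟨h0, h⟩ j
      by_cases hj : j = i
      · subst hj; simpa using h0
      · simpa [hj] using h j
  rw [this, Measure.prod_prod, Measure.pi_pi, ← Finset.mul_prod_erase _ _ (Finset.mem_univ i),
    ← Finset.mul_prod_erase (a := i) _ (fun j => μ (s j)) (Finset.mem_univ i)]
  simp only [Function.update_self, measure_univ, one_mul]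
  congr 1
  exact Finset.prod_congr rfl fun j hj => by simp [Finset.ne_of_mem_erase hj]

theorem integrable_eval_gaussianPi (i : ι) : Integrable (fun ω => ω i) (gaussianPi ι) :=
  integrable_comp_eval (μ := fun _ : ι => gaussianReal 0 1) (f := fun x : ℝ => x)
    integrable_id_gaussianReal

theorem integral_eval_mul_gaussianPi [DecidableEq ι] (i : ι) {G G' : (ι → ℝ) → ℝ}
    (hG : Continuous G) (hG' : Continuous G') {C : ℝ}
    (hC : ∀ ω, |G ω| ≤ C) (hC' : ∀ ω, |G' ω| ≤ C)
    (hd : ∀ ω x, HasDerivAt (fun x => G (Function.update ω i x)) (G' (Function.update ω i x)) x) :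
    ∫ ω, ω i * G ω ∂gaussianPi ι = ∫ ω, G' ω ∂gaussianPi ι := by
  have hmp : MeasurePreserving (fun q : ℝ × (ι → ℝ) => Function.update q.2 i q.1)
      ((gaussianReal 0 1).prod (gaussianPi ι)) (gaussianPi ι) :=
    measurePreserving_update (gaussianReal 0 1) i
  have hi1 : Integrable (fun ω => ω i * G ω) (gaussianPi ι) :=
    (integrable_eval_gaussianPi i).mul_bdd hG.aestronglyMeasurable (ae_of_all _ hC)
  have hi2 : Integrable G' (gaussianPi ι) :=
    Integrable.of_bound hG'.aestronglyMeasurable C (ae_of_all _ hC')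
  rw [← hmp.map_eq] at hi1 hi2
  have hj1 := integral_prod_symm _ (hi1.comp_measurable hmp.measurable)
  have hj2 := integral_prod_symm _ (hi2.comp_measurable hmp.measurable)
  simp only [Function.comp_apply] at hj1 hj2
  rw [← hmp.map_eq, integral_map hmp.aemeasurable hi1.1, integral_map hmp.aemeasurable hi2.1,
    hj1, hj2]
  congr 1
  ext ω
  simp only [Function.update_self]
  refine integral_id_mul_gaussianReal (hd ω) ?_ (fun x => hC _) fun x => hC' _
  exact (hG'.comp (continuous_const.update i continuous_id)).measurable

theorem integrable_dotProduct_gaussianPi (d : ι → ℝ) :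
    Integrable (fun ω => d ⬝ᵥ ω) (gaussianPi ι) :=
  integrable_finsetSum _ fun i _ => (integrable_eval_gaussianPi i).const_mul (d i)

variable {κ : Type*} [Fintype κ]

/-- Gaussian integration by parts for a function of finitely many linear forms. -/
theorem integral_dotProduct_mul_gaussianPi (c : κ → ι → ℝ) (d : ι → ℝ)
    {g : (κ → ℝ) → ℝ} {g' : κ → (κ → ℝ) → ℝ}
    (hg : ∀ z, HasFDerivAt g (∑ l, g' l z • ContinuousLinearMap.proj (R := ℝ) l) z)
    (hg' : ∀ l, Continuous (g' l)) {C : ℝ} (hC : ∀ z, |g z| ≤ C) (hC' : ∀ l z, |g' l z| ≤ C) :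
    ∫ ω, (d ⬝ᵥ ω) * g (fun k => c k ⬝ᵥ ω) ∂gaussianPi ι =
      ∑ l, (d ⬝ᵥ c l) * ∫ ω, g' l (fun k => c k ⬝ᵥ ω) ∂gaussianPi ι := by
  classical
  have hgc : Continuous g := continuous_iff_continuousAt.2 fun z => (hg z).continuousAt
  have hZ : Continuous fun (ω : ι → ℝ) k => c k ⬝ᵥ ω :=
    continuous_pi fun k => continuous_const.dotProduct continuous_id
  have hint : ∀ l, Integrable (fun ω => g' l (fun k => c k ⬝ᵥ ω)) (gaussianPi ι) := fun l =>
    Integrable.of_bound ((hg' l).comp hZ).aestronglyMeasurable C (ae_of_all _ fun ω => hC' l _)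
  have hcoord : ∀ i, ∫ ω, ω i * g (fun k => c k ⬝ᵥ ω) ∂gaussianPi ι =
      ∑ l, c l i * ∫ ω, g' l (fun k => c k ⬝ᵥ ω) ∂gaussianPi ι := by
    intro i
    rw [integral_eval_mul_gaussianPi i (G := fun ω => g fun k => c k ⬝ᵥ ω)
      (G' := fun ω => ∑ l, c l i * g' l (fun k => c k ⬝ᵥ ω))
      -- A single constant has to dominate both the function and its partial derivative.
      (C := C + ∑ l, |c l i| * C) (hgc.comp hZ)
      (continuous_finsetSum _ fun l _ => continuous_const.mul ((hg' l).comp hZ)),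
      integral_finsetSum _ fun l _ => (hint l).const_mul _]
    · simp_rw [integral_const_mul]
    · intro ω
      have h0 : 0 ≤ C := (abs_nonneg _).trans (hC 0)
      exact (hC _).trans (le_add_of_nonneg_right (by positivity))
    · intro ω
      have h0 : 0 ≤ C := (abs_nonneg _).trans (hC 0)
      refine (Finset.abs_sum_le_sum_abs _ _).trans (le_add_of_nonneg_of_le h0 ?_)
      refine Finset.sum_le_sum fun l _ => ?_
      rw [abs_mul]
      gcongr
      exact hC' l _
    · intro ω x
      have hz : HasDerivAt (fun x (k : κ) => c k ⬝ᵥ Function.update ω i x) (fun k => c k i) x := by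
        refine hasDerivAt_pi.2 fun k => ?_
        have h1 : HasDerivAt (fun x => ∑ j, c k j * Function.update ω i x j)
            (∑ j, c k j * (Pi.single i (1 : ℝ) : ι → ℝ) j) x :=
          HasDerivAt.fun_sum fun j _ =>
            ((hasDerivAt_pi.1 (hasDerivAt_update ω i x)) j).const_mul (c k j)
        convert! h1 using 1
        simp [Pi.single_apply]
      convert! (hg (fun k => c k ⬝ᵥ Function.update ω i x)).comp_hasDerivAt x hz using 1
      simp [mul_comm]
  calc _ = ∫ ω, ∑ i, d i * (ω i * g (fun k => c k ⬝ᵥ ω)) ∂gaussianPi ι := by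
        congr 1; ext ω; simp only [dotProduct, Finset.sum_mul, mul_assoc]
    _ = ∑ i, d i * ∑ l, c l i * ∫ ω, g' l (fun k => c k ⬝ᵥ ω) ∂gaussianPi ι := by
      rw [integral_finsetSum]
      · simp_rw [integral_const_mul, hcoord]
      · intro i _
        exact ((integrable_eval_gaussianPi i).mul_bdd (hgc.comp hZ).aestronglyMeasurable
          (ae_of_all _ fun ω => hC _)).const_mul _
    _ = _ := by
      simp_rw [Finset.mul_sum, dotProduct, Finset.sum_mul]
      rw [Finset.sum_comm]
      simp_rw [mul_assoc]

end GaussianIntegrationByParts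

/-! ### Kahane's and Slepian's comparison inequalities. -/

section GaussianComparison

variable {ι κ : Type*} [Fintype ι] [Fintype κ]

/-- Kahane's comparison inequality: if the independent Gaussian families `ω ↦ a k ⬝ᵥ ω` and
`ω ↦ b k ⬝ᵥ ω` have equal variances and the first one has the larger covariances, then
`E F(b) ≤ E F(a)` for every `F` whose mixed second derivatives are nonnegative. -/
theorem integral_gaussianPi_le_of_covariance_le (a b : κ → ι → ℝ)
    (hab : ∀ k l, a k ⬝ᵥ b l = 0) (hdiag : ∀ k, b k ⬝ᵥ b k = a k ⬝ᵥ a k)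
    (hoff : ∀ k l, b k ⬝ᵥ b l ≤ a k ⬝ᵥ a l)
    {F : (κ → ℝ) → ℝ} {F₁ : κ → (κ → ℝ) → ℝ} {F₂ : κ → κ → (κ → ℝ) → ℝ}
    (hF₁ : ∀ z, HasFDerivAt F (∑ k, F₁ k z • ContinuousLinearMap.proj (R := ℝ) k) z)
    (hF₂ : ∀ k z, HasFDerivAt (F₁ k) (∑ l, F₂ k l z • ContinuousLinearMap.proj (R := ℝ) l) z)
    (hF₂c : ∀ k l, Continuous (F₂ k l)) {C : ℝ} (hC : ∀ z, |F z| ≤ C)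
    (hC₁ : ∀ k z, |F₁ k z| ≤ C) (hC₂ : ∀ k l z, |F₂ k l z| ≤ C)
    (hpos : ∀ k l, k ≠ l → ∀ z, 0 ≤ F₂ k l z) :
    ∫ ω, F (fun k => b k ⬝ᵥ ω) ∂gaussianPi ι ≤ ∫ ω, F (fun k => a k ⬝ᵥ ω) ∂gaussianPi ι := by
  have hFc : Continuous F := continuous_iff_continuousAt.2 fun z => (hF₁ z).continuousAt
  have hF₁c : ∀ k, Continuous (F₁ k) := fun k =>
    continuous_iff_continuousAt.2 fun z => (hF₂ k z).continuousAt
  have hC0 : 0 ≤ C := (abs_nonneg _).trans (hC 0)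
  -- The path rotates from `a` at `θ = 0` to `b` at `θ = π/2`, and `d` is its velocity.
  let c : ℝ → κ → ι → ℝ := fun θ k => Real.cos θ • a k + Real.sin θ • b k
  let d : ℝ → κ → ι → ℝ := fun θ k => -Real.sin θ • a k + Real.cos θ • b k
  have hZ : ∀ θ, Continuous fun (ω : ι → ℝ) k => c θ k ⬝ᵥ ω := fun θ =>
    continuous_pi fun k => continuous_const.dotProduct continuous_id
  have hcd : ∀ (e : κ → ι → ℝ) k ω x y, (x • a k + y • e k) ⬝ᵥ ω =
      x * (a k ⬝ᵥ ω) + y * (e k ⬝ᵥ ω) := fun e k ω x y => by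
    rw [add_dotProduct, smul_dotProduct, smul_dotProduct, smul_eq_mul, smul_eq_mul]
  have hderiv : ∀ θ, HasDerivAt (fun θ => ∫ ω, F (fun k => c θ k ⬝ᵥ ω) ∂gaussianPi ι)
      (∫ ω, ∑ k, (d θ k ⬝ᵥ ω) * F₁ k (fun k => c θ k ⬝ᵥ ω) ∂gaussianPi ι) θ := by
    intro θ
    refine (hasDerivAt_integral_of_dominated_loc_of_deriv_le (s := Set.univ)
      (F' := fun θ ω => ∑ k, (d θ k ⬝ᵥ ω) * F₁ k (fun k => c θ k ⬝ᵥ ω))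
      (bound := fun ω => ∑ k, (|a k ⬝ᵥ ω| + |b k ⬝ᵥ ω|) * C)
      Filter.univ_mem (Eventually.of_forall fun θ => (hFc.comp (hZ θ)).aestronglyMeasurable)
      (Integrable.of_bound (hFc.comp (hZ θ)).aestronglyMeasurable C (ae_of_all _ fun ω => hC _))
      ?_ (ae_of_all _ fun ω θ _ => ?_) ?_ (ae_of_all _ fun ω θ _ => ?_)).2
    · exact (continuous_finsetSum _ fun k _ => (continuous_const.dotProduct continuous_id).mul
        ((hF₁c k).comp (hZ θ))).aestronglyMeasurable
    · refine (norm_sum_le _ _).trans (Finset.sum_le_sum fun k _ => ?_)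
      rw [norm_mul, Real.norm_eq_abs, Real.norm_eq_abs]
      gcongr
      · rw [hcd]
        refine (abs_add_le _ _).trans (add_le_add ?_ ?_)
        · rw [abs_mul, abs_neg]
          exact mul_le_of_le_one_left (abs_nonneg _) (Real.abs_sin_le_one θ)
        · rw [abs_mul]
          exact mul_le_of_le_one_left (abs_nonneg _) (Real.abs_cos_le_one θ)
      · exact hC₁ k _
    · exact integrable_finsetSum _ fun k _ => ((integrable_dotProduct_gaussianPi _).abs.add
        (integrable_dotProduct_gaussianPi _).abs).mul_const C
    · have hz : HasDerivAt (fun θ (k : κ) => c θ k ⬝ᵥ ω) (fun k => d θ k ⬝ᵥ ω) θ := by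
        refine hasDerivAt_pi.2 fun k => ?_
        simp only [c, d, hcd]
        exact ((Real.hasDerivAt_cos θ).mul_const _).add ((Real.hasDerivAt_sin θ).mul_const _)
      convert! (hF₁ (fun k => c θ k ⬝ᵥ ω)).comp_hasDerivAt θ hz using 1
      simp [mul_comm]
  have hdc : ∀ θ k l, d θ k ⬝ᵥ c θ l =
      Real.sin θ * Real.cos θ * (b k ⬝ᵥ b l - a k ⬝ᵥ a l) := by
    intro θ k l
    simp only [c, d, add_dotProduct, dotProduct_add, smul_dotProduct, dotProduct_smul,
      smul_eq_mul, hab, dotProduct_comm (b k) (a l)]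
    ring
  -- Integration by parts turns the derivative into a sum of `(d k · c l) E F₂ k l`. The diagonal
  -- terms vanish by equality of variances; the others pair a nonpositive covariance difference with
  -- a nonnegative mixed derivative.
  have hnonpos : ∀ θ ∈ Set.Icc 0 (Real.pi / 2),
      ∫ ω, ∑ k, (d θ k ⬝ᵥ ω) * F₁ k (fun k => c θ k ⬝ᵥ ω) ∂gaussianPi ι ≤ 0 := by
    intro θ hθ
    rw [integral_finsetSum]
    · refine Finset.sum_nonpos fun k _ => ?_
      rw [integral_dotProduct_mul_gaussianPi (c θ) (d θ k) (hF₂ k) (hF₂c k) (hC₁ k) (hC₂ k)]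
      refine Finset.sum_nonpos fun l _ => ?_
      rw [hdc]
      rcases eq_or_ne k l with rfl | hkl
      · simp [hdiag]
      · refine mul_nonpos_of_nonpos_of_nonneg (mul_nonpos_of_nonneg_of_nonpos ?_ ?_)
          (integral_nonneg fun ω => hpos k l hkl _)
        · exact mul_nonneg (Real.sin_nonneg_of_nonneg_of_le_pi hθ.1
            (by linarith [hθ.2, Real.pi_pos]))
            (Real.cos_nonneg_of_neg_pi_div_two_le_of_le (by linarith [hθ.1, Real.pi_pos]) hθ.2)
        · linarith [hoff k l]
    · intro k _
      exact (integrable_dotProduct_gaussianPi _).mul_bdd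
        ((hF₁c k).comp (hZ θ)).aestronglyMeasurable (ae_of_all _ fun ω => hC₁ k _)
  have hanti := antitoneOn_of_deriv_nonpos (convex_Icc 0 (Real.pi / 2))
    (fun θ _ => (hderiv θ).continuousAt.continuousWithinAt)
    (fun θ _ => (hderiv θ).differentiableAt.differentiableWithinAt)
    (fun θ hθ => by rw [(hderiv θ).deriv]; exact hnonpos θ (interior_subset hθ))
  have h := hanti (Set.left_mem_Icc.2 (by positivity)) (Set.right_mem_Icc.2 (by positivity))
    (by positivity)
  simpa [c] using h

/-- Writing each partial derivative as a product of updated factors keeps the product form, so the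
rule can be applied a second time. -/
theorem hasFDerivAt_prod_eval [DecidableEq κ] {φ φ' : κ → ℝ → ℝ}
    (h : ∀ k x, HasDerivAt (φ k) (φ' k x) x) (z : κ → ℝ) :
    HasFDerivAt (fun z : κ → ℝ => ∏ k, φ k (z k))
      (∑ l, (∏ k, Function.update φ l (φ' l) k (z k)) •
        ContinuousLinearMap.proj (R := ℝ) (φ := fun _ : κ => ℝ) l) z := by
  have := HasFDerivAt.finsetProd (u := Finset.univ) (g := fun k (z : κ → ℝ) => φ k (z k))
    (g' := fun k => φ' k (z k) • ContinuousLinearMap.proj (R := ℝ) (φ := fun _ : κ => ℝ) k) (x := z)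
    fun k _ => (h k (z k)).comp_hasFDerivAt z 
      (ContinuousLinearMap.proj (R := ℝ) (φ := fun _ : κ => ℝ) k).hasFDerivAt
  refine this.congr_fderiv (Finset.sum_congr rfl fun l _ => ?_)
  rw [smul_smul, ← Finset.mul_prod_erase (a := l) _ (fun k => Function.update φ l (φ' l) k (z k))
    (Finset.mem_univ l), Function.update_self, mul_comm]
  congr 2
  exact Finset.prod_congr rfl fun k hk => by rw [Function.update_of_ne (Finset.ne_of_mem_erase hk)]

theorem abs_prod_eval_le {φ : κ → ℝ → ℝ} {B : ℝ} (h : ∀ k x, |φ k x| ≤ B) (z : κ → ℝ) :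
    |∏ k, φ k (z k)| ≤ B ^ Fintype.card κ := by
  rw [Finset.abs_prod, ← Finset.card_univ, ← Finset.prod_const]
  exact Finset.prod_le_prod (fun _ _ => abs_nonneg _) fun k _ => h k _

/-- Slepian's inequality for the product of a decreasing function of the coordinates. -/
theorem integral_prod_gaussianPi_le (a b : κ → ι → ℝ)
    (hab : ∀ k l, a k ⬝ᵥ b l = 0) (hdiag : ∀ k, b k ⬝ᵥ b k = a k ⬝ᵥ a k)
    (hoff : ∀ k l, b k ⬝ᵥ b l ≤ a k ⬝ᵥ a l)
    {ψ ψ₁ ψ₂ : ℝ → ℝ} (h₁ : ∀ x, HasDerivAt ψ (ψ₁ x) x) (h₂ : ∀ x, HasDerivAt ψ₁ (ψ₂ x) x)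
    (hc : Continuous ψ₂) {B : ℝ} (hB : ∀ x, |ψ x| ≤ B) (hB₁ : ∀ x, |ψ₁ x| ≤ B)
    (hB₂ : ∀ x, |ψ₂ x| ≤ B) (hψ : ∀ x, 0 ≤ ψ x) (hψ₁ : ∀ x, ψ₁ x ≤ 0) :
    ∫ ω, ∏ k, ψ (b k ⬝ᵥ ω) ∂gaussianPi ι ≤ ∫ ω, ∏ k, ψ (a k ⬝ᵥ ω) ∂gaussianPi ι := by
  classical
  have hψc : Continuous ψ := continuous_iff_continuousAt.2 fun z => (h₁ z).continuousAt
  have hψ₁c : Continuous ψ₁ := continuous_iff_continuousAt.2 fun z => (h₂ z).continuousAt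
  let φ : κ → ℝ → ℝ := fun _ => ψ
  let φ₁ : κ → κ → ℝ → ℝ := fun k => Function.update φ k ψ₁
  let δ₁ : κ → κ → ℝ → ℝ := fun k l => if l = k then ψ₂ else ψ₁
  let φ₂ : κ → κ → κ → ℝ → ℝ := fun k l => Function.update (φ₁ k) l (δ₁ k l)
  have hφ₁ : ∀ k l, φ₁ k l = if l = k then ψ₁ else ψ := fun k l => by
    simp [φ₁, φ, Function.update_apply]
  have hφ₂ : ∀ k l m, φ₂ k l m = ψ ∨ φ₂ k l m = ψ₁ ∨ φ₂ k l m = ψ₂ := fun k l m => by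
    simp only [φ₂, δ₁, Function.update_apply, hφ₁]
    split_ifs <;> simp
  refine integral_gaussianPi_le_of_covariance_le a b hab hdiag hoff
    (F := fun z => ∏ k, φ k (z k)) (F₁ := fun k z => ∏ j, φ₁ k j (z j))
    (F₂ := fun k l z => ∏ j, φ₂ k l j (z j)) (C := B ^ Fintype.card κ)
    (hasFDerivAt_prod_eval fun _ => h₁) (fun k => hasFDerivAt_prod_eval fun l x => ?_)
    (fun k l => continuous_finsetProd _ fun m _ => ?_) (abs_prod_eval_le fun _ => hB)
    (fun k => abs_prod_eval_le fun l x => ?_) (fun k l => abs_prod_eval_le fun m x => ?_)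
    fun k l hkl z => ?_
  · rw [hφ₁]
    simp only [δ₁]
    split_ifs
    · exact h₂ x
    · exact h₁ x
  · rcases hφ₂ k l m with h | h | h <;> rw [h] <;> fun_prop
  · rw [hφ₁]
    split_ifs
    · exact hB₁ x
    · exact hB x
  · rcases hφ₂ k l m with h | h | h <;> rw [h]
    exacts [hB x, hB₁ x, hB₂ x]
  -- For `k ≠ l` the mixed derivative contains two nonpositive factors `ψ₁`; all other factors are
  -- `ψ ≥ 0`.
  · have hl : l ∈ Finset.univ.erase k := Finset.mem_erase.2 ⟨hkl.symm, Finset.mem_univ l⟩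
    rw [← Finset.mul_prod_erase _ _ (Finset.mem_univ k), ← Finset.mul_prod_erase _ _ hl,
      ← mul_assoc]
    refine mul_nonneg (mul_nonneg_of_nonpos_of_nonpos ?_ ?_) (Finset.prod_nonneg fun m hm => ?_)
    · simp [φ₂, hφ₁, hkl, hψ₁]
    · simp [φ₂, δ₁, hkl.symm, hψ₁]
    · simp only [Finset.mem_erase] at hm
      simp [φ₂, hφ₁, hm.1, hm.2.1, hψ]

/-- A bump bounded in `C²` that decreases from one on `(-∞, c - 1]` to zero on `[c, ∞)`. -/
theorem exists_smooth_cutoff (c : ℝ) : ∃ (ψ ψ₁ ψ₂ : ℝ → ℝ) (B : ℝ),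
    (∀ x, HasDerivAt ψ (ψ₁ x) x) ∧ (∀ x, HasDerivAt ψ₁ (ψ₂ x) x) ∧ Continuous ψ₂ ∧
    (∀ x, |ψ x| ≤ B) ∧ (∀ x, |ψ₁ x| ≤ B) ∧ (∀ x, |ψ₂ x| ≤ B) ∧ (∀ x, 0 ≤ ψ x) ∧
    (∀ x, ψ₁ x ≤ 0) ∧ (∀ x, ψ x ≤ 1) ∧ (∀ x, x ≤ c - 1 → ψ x = 1) ∧ ∀ x, c ≤ x → ψ x = 0 := by
  set ψ : ℝ → ℝ := fun x => Real.smoothTransition (c - x) with hψ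
  have hsm : ContDiff ℝ 2 ψ := by
    have h : ContDiff ℝ 2 Real.smoothTransition := Real.smoothTransition.contDiff (n := 2)
    exact h.comp (contDiff_const.sub contDiff_id)
  have hsm₁ : ContDiff ℝ 1 (deriv ψ) := by
    have := (contDiff_succ_iff_deriv (n := 1) (f := ψ)).1 (by simpa [one_add_one_eq_two] using hsm)
    exact this.2.2
  have hc₂ : Continuous (deriv (deriv ψ)) := hsm₁.continuous_deriv le_rfl
  have hanti : Antitone ψ := fun x y h => Real.smoothTransition.monotone (by linarith)
  -- Off a compact interval `ψ` is locally constant, so continuity there bounds both derivatives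
  -- globally.
  have hloc : ∀ x, x ∉ Set.Icc (c - 1) c → deriv ψ x = 0 ∧ deriv (deriv ψ) x = 0 := by
    intro x hx
    have hev : ∃ r : ℝ, ψ =ᶠ[𝓝 x] fun _ => r := by
      rcases lt_or_ge x (c - 1) with h | h
      · refine ⟨1, ?_⟩
        filter_upwards [Iio_mem_nhds h] with y hy
        exact Real.smoothTransition.one_of_one_le (by linarith [Set.mem_Iio.1 hy])
      · have h' : c < x := by
          by_contra h'
          exact hx ⟨h, not_lt.1 h'⟩
        refine ⟨0, ?_⟩
        filter_upwards [Ioi_mem_nhds h'] with y hy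
        exact Real.smoothTransition.zero_of_nonpos (by linarith [Set.mem_Ioi.1 hy])
    obtain ⟨r, hr⟩ := hev
    have h1 : deriv ψ =ᶠ[𝓝 x] fun _ => 0 := by
      simpa using hr.deriv
    exact ⟨h1.eq_of_nhds, by simpa using h1.deriv_eq⟩
  obtain ⟨B₁, hB₁⟩ := (isCompact_Icc (a := c - 1) (b := c)).exists_bound_of_continuousOn
    hsm₁.continuous.continuousOn
  obtain ⟨B₂, hB₂⟩ := (isCompact_Icc (a := c - 1) (b := c)).exists_bound_of_continuousOn
    hc₂.continuousOn
  have hB1 : 1 ≤ max 1 (max B₁ B₂) := le_max_left _ _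
  refine ⟨ψ, deriv ψ, deriv (deriv ψ), max 1 (max B₁ B₂),
    fun x => (hsm.differentiable (by norm_num) x).hasDerivAt,
    fun x => (hsm₁.differentiable (by norm_num) x).hasDerivAt, hc₂, fun x => ?_, fun x => ?_,
    fun x => ?_, fun x => Real.smoothTransition.nonneg _, fun x => hanti.deriv_nonpos,
    fun x => Real.smoothTransition.le_one _,
    fun x hx => Real.smoothTransition.one_of_one_le (by linarith),
    fun x hx => Real.smoothTransition.zero_of_nonpos (by linarith)⟩
  · rw [abs_of_nonneg (Real.smoothTransition.nonneg _)]
    exact (Real.smoothTransition.le_one _).trans hB1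
  · by_cases hx : x ∈ Set.Icc (c - 1) c
    · exact (hB₁ x hx).trans ((le_max_left _ _).trans (le_max_right _ _))
    · rw [(hloc x hx).1, abs_zero]; positivity
  · by_cases hx : x ∈ Set.Icc (c - 1) c
    · exact (hB₂ x hx).trans ((le_max_right _ _).trans (le_max_right _ _))
    · rw [(hloc x hx).2, abs_zero]; positivity

/-- Slepian's inequality for the tails of the maxima, with a loss of one in the level. -/
theorem gaussianPi_exists_ge_le (a b : κ → ι → ℝ)
    (hab : ∀ k l, a k ⬝ᵥ b l = 0) (hdiag : ∀ k, b k ⬝ᵥ b k = a k ⬝ᵥ a k)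
    (hoff : ∀ k l, b k ⬝ᵥ b l ≤ a k ⬝ᵥ a l) (c : ℝ) :
    (gaussianPi ι).real {ω | ∃ k, c ≤ a k ⬝ᵥ ω} ≤
      (gaussianPi ι).real {ω | ∃ k, c - 1 < b k ⬝ᵥ ω} := by
  obtain ⟨ψ, ψ₁, ψ₂, B, h₁, h₂, hc, hB, hB₁, hB₂, hψ, hψ₁, hψle, hone, hzero⟩ :=
    exists_smooth_cutoff c
  have key := integral_prod_gaussianPi_le a b hab hdiag hoff h₁ h₂ hc hB hB₁ hB₂ hψ hψ₁
  have hψc : Continuous ψ := continuous_iff_continuousAt.2 fun z => (h₁ z).continuousAt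
  have hcont : ∀ e : κ → ι → ℝ, Continuous fun ω => ∏ k, ψ (e k ⬝ᵥ ω) := fun e =>
    continuous_finsetProd _ fun k _ => hψc.comp (continuous_const.dotProduct continuous_id)
  have hle1 : ∀ (e : κ → ι → ℝ) ω, ∏ k, ψ (e k ⬝ᵥ ω) ≤ 1 := fun e ω =>
    Finset.prod_le_one (fun _ _ => hψ _) fun _ _ => hψle _
  have hnn : ∀ (e : κ → ι → ℝ) ω, 0 ≤ ∏ k, ψ (e k ⬝ᵥ ω) := fun e ω =>
    Finset.prod_nonneg fun _ _ => hψ _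
  have hint : ∀ e : κ → ι → ℝ, Integrable (fun ω => ∏ k, ψ (e k ⬝ᵥ ω)) (gaussianPi ι) := fun e =>
    Integrable.of_bound (hcont e).aestronglyMeasurable 1 (ae_of_all _ fun ω => by
      rw [Real.norm_eq_abs, abs_of_nonneg (hnn e ω)]; exact hle1 e ω)
  have hmA : MeasurableSet {ω : ι → ℝ | ∃ k, c ≤ a k ⬝ᵥ ω} := by
    rw [Set.ofPred_exists]
    exact MeasurableSet.iUnion fun k => (isClosed_le continuous_const
      (continuous_const.dotProduct continuous_id)).measurableSet
  have hmB : MeasurableSet {ω : ι → ℝ | ∃ k, c - 1 < b k ⬝ᵥ ω} := by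
    rw [Set.ofPred_exists]
    exact MeasurableSet.iUnion fun k => (isOpen_lt continuous_const
      (continuous_const.dotProduct continuous_id)).measurableSet
  -- The product of cutoffs lies between the indicators of "all values at most `c - 1`" and "all
  -- values below `c`"; this gap is the loss of one.
  have hA : ∫ ω, ∏ k, ψ (a k ⬝ᵥ ω) ∂gaussianPi ι ≤
      (gaussianPi ι).real {ω | ∃ k, c ≤ a k ⬝ᵥ ω}ᶜ := by
    rw [← integral_indicator_one hmA.compl]
    refine integral_mono (hint a) ((integrable_const 1).indicator hmA.compl) fun ω => ?_
    by_cases hω : ω ∈ {ω : ι → ℝ | ∃ k, c ≤ a k ⬝ᵥ ω}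
    · obtain ⟨k, hk⟩ := hω
      change ∏ k, ψ (a k ⬝ᵥ ω) ≤ _
      rw [Finset.prod_eq_zero (Finset.mem_univ k) (hzero _ hk)]
      exact Set.indicator_nonneg (fun _ _ => zero_le_one) _
    · rw [Set.indicator_of_mem (show ω ∈ _ᶜ from hω)]
      exact hle1 a ω
  have hB' : (gaussianPi ι).real {ω | ∃ k, c - 1 < b k ⬝ᵥ ω}ᶜ ≤
      ∫ ω, ∏ k, ψ (b k ⬝ᵥ ω) ∂gaussianPi ι := by
    rw [← integral_indicator_one hmB.compl]
    refine integral_mono ((integrable_const 1).indicator hmB.compl) (hint b) fun ω => ?_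
    by_cases hω : ω ∈ {ω : ι → ℝ | ∃ k, c - 1 < b k ⬝ᵥ ω}
    · rw [Set.indicator_of_notMem (by simpa using hω)]
      exact hnn b ω
    · rw [Set.indicator_of_mem (show ω ∈ _ᶜ from hω)]
      change _ ≤ ∏ k, ψ (b k ⬝ᵥ ω)
      rw [Finset.prod_eq_one fun k _ => hone _ (not_lt.1 fun h => hω ⟨k, h⟩)]
      simp
  have := hB'.trans (key.trans hA)
  rw [probReal_compl_eq_one_sub hmA, probReal_compl_eq_one_sub hmB] at this
  linarith

end GaussianComparison

/-! ### Tails of the norm of a Gaussian vector. -/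

section NormTails

theorem memLp_sq_gaussianReal : MemLp (fun x : ℝ => x ^ 2) 2 (gaussianReal 0 1) := by
  have h := (memLp_id_gaussianReal' (μ := 0) (v := 1) 4 (by simp)).integrable_norm_pow (by simp)
  refine (memLp_two_iff_integrable_sq (by fun_prop)).2 ?_
  convert! h using 2 with x
  simp only [id, Real.norm_eq_abs]
  rw [← pow_mul, ← abs_pow, abs_of_nonneg (by positivity)]

theorem integral_sq_gaussianReal : ∫ x, x ^ 2 ∂gaussianReal 0 1 = 1 := by
  have h := variance_fun_id_gaussianReal (μ := 0) (v := 1)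
  rw [variance_of_integral_eq_zero (by fun_prop) integral_id_gaussianReal] at h
  simpa using h

variable {ι : Type*} [Fintype ι]

/-- Chebyshev's inequality for the Euclidean norm of finitely many standard normal variables. -/
theorem gaussianPi_sqrt_sum_sq_ge_le (S : Finset ι) (hS : S.Nonempty) {d : ℝ} (hd : 0 < d) :
    gaussianPi ι {ω | √(S.card : ℝ) + d ≤ √(∑ i ∈ S, ω i ^ 2)} ≤
      ENNReal.ofReal (Var[fun x => x ^ 2; gaussianReal 0 1] / d ^ 2) := by
  classical
  set V := Var[fun x => x ^ 2; gaussianReal 0 1] with hV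
  let f : ι → ℝ → ℝ := fun i x => if i ∈ S then x ^ 2 else 0
  have hf : ∀ i, MemLp (f i) 2 (gaussianReal 0 1) := fun i => by
    by_cases h : i ∈ S
    · simpa [f, h] using memLp_sq_gaussianReal
    · simp [f, h]
  have hcard : (0 : ℝ) < S.card := by exact_mod_cast hS.card_pos
  have hvar : Var[∑ i, fun ω => f i (ω i); gaussianPi ι] = S.card * V := by
    rw [variance_sum_pi hf]
    have : ∀ i, Var[f i; gaussianReal 0 1] = if i ∈ S then V else 0 := fun i => by
      by_cases h : i ∈ S
      · simp [f, h, hV]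
      · simp only [f, h, if_false]
        exact variance_zero _
    simp [this]
  have hmemi : ∀ i, MemLp (fun ω => f i (ω i)) 2 (gaussianPi ι) := fun i =>
    (hf i).comp_measurePreserving (measurePreserving_eval (fun _ : ι => gaussianReal 0 1) i)
  have hmem : MemLp (∑ i, fun ω => f i (ω i)) 2 (gaussianPi ι) :=
    memLp_finsetSum' _ fun i _ => hmemi i
  have hmean : ∫ ω, (∑ i, fun ω => f i (ω i)) ω ∂gaussianPi ι = S.card := by
    simp only [Finset.sum_apply]
    rw [integral_finsetSum _ fun i _ => (hmemi i).integrable (by norm_num)]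
    have : ∀ i, ∫ ω, f i (ω i) ∂gaussianPi ι = if i ∈ S then 1 else 0 := fun i => by
      rw [integral_comp_eval (μ := fun _ : ι => gaussianReal 0 1) (hf i).1]
      by_cases h : i ∈ S
      · simp [f, h, integral_sq_gaussianReal]
      · simp [f, h]
    simp [this]
  -- At deviation `√|S| d` the factor `|S|` in the variance cancels. This level suffices because
  -- `(√|S| + d)² - |S| ≥ √|S| d`.
  have hcheb := meas_ge_le_variance_div_sq hmem (c := √S.card * d) (by positivity)
  rw [hmean, hvar, mul_pow, Real.sq_sqrt hcard.le, mul_div_mul_left _ _ hcard.ne'] at hcheb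
  refine (measure_mono fun ω hω => ?_).trans hcheb
  have hsum : (∑ i, fun ω : ι → ℝ => f i (ω i)) ω = ∑ i ∈ S, ω i ^ 2 := by
    simp [f, Finset.sum_apply]
  rw [Set.mem_ofPred_eq, hsum]
  have h0 := Real.sq_sqrt hcard.le
  have h1 := Real.sq_sqrt (Finset.sum_nonneg fun i (_ : i ∈ S) => sq_nonneg (ω i))
  have hω' : √(S.card : ℝ) + d ≤ √(∑ i ∈ S, ω i ^ 2) := hω
  refine le_trans ?_ (le_abs_self _)
  nlinarith [Real.sqrt_nonneg (S.card : ℝ), mul_nonneg (Real.sqrt_nonneg (S.card : ℝ)) hd.le]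

theorem dotProduct_le_sqrt_mul_sqrt (x y : ι → ℝ) :
    x ⬝ᵥ y ≤ √(∑ i, x i ^ 2) * √(∑ i, y i ^ 2) :=
  Real.sum_mul_le_sqrt_mul_sqrt _ _ _

end NormTails

/-! ### Operator norm of a Gaussian matrix. -/

section GaussianMatrix

variable {p n : ℕ}

/-- Coordinates carrying a `p × n` matrix, one scalar, and vectors of sizes `p` and `n`. -/
abbrev ComparisonIndex (p n : ℕ) : Type := (Fin p × Fin n) ⊕ (Unit ⊕ (Fin p ⊕ Fin n))

theorem gaussianPi_comparisonIndex_exists_ge_le {κ : Type*} [Fintype κ] (hp : 0 < p) (hn : 0 < n)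
    (u : κ → Fin p → ℝ) (v : κ → Fin n → ℝ) (hu : ∀ k, ∑ i, u k i ^ 2 = 1)
    (hv : ∀ k, ∑ j, v k j ^ 2 = 1) {s : ℝ} (hs : 8 ≤ s) :
    gaussianPi (ComparisonIndex p n)
        {ω | ∃ k, svThreshold p n s ≤ ∑ i, ∑ j, u k i * v k j * ω (Sum.inl (i, j))} ≤
      3 * ENNReal.ofReal (Var[fun x => x ^ 2; gaussianReal 0 1] / (s / 8) ^ 2) := by
  classical
  -- The constant coefficient on the `Unit` coordinate is the auxiliary normal `γ`; it raises the
  -- variance to `2`, that of `b`.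
  let a : κ → ComparisonIndex p n → ℝ := fun k =>
    Sum.elim (fun e => u k e.1 * v k e.2) (Sum.elim (fun _ => 1) fun _ => 0)
  let b : κ → ComparisonIndex p n → ℝ := fun k =>
    Sum.elim (fun _ => 0) (Sum.elim (fun _ => 0) (Sum.elim (u k) (v k)))
  have haω : ∀ k ω, a k ⬝ᵥ ω =
      (∑ i, ∑ j, u k i * v k j * ω (Sum.inl (i, j))) + ω (Sum.inr (Sum.inl ())) := by
    intro k ω
    simp [a, dotProduct, Fintype.sum_sum_type, Fintype.sum_prod_type]
  have hbω : ∀ k ω, b k ⬝ᵥ ω = (u k ⬝ᵥ fun i => ω (Sum.inr (Sum.inr (Sum.inl i)))) +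
      (v k ⬝ᵥ fun i => ω (Sum.inr (Sum.inr (Sum.inr i)))) := by
    intro k ω
    simp [b, dotProduct, Fintype.sum_sum_type]
  have haa : ∀ k l, a k ⬝ᵥ a l = (u k ⬝ᵥ u l) * (v k ⬝ᵥ v l) + 1 := by
    intro k l
    rw [haω]
    simp only [a, Sum.elim_inl, Sum.elim_inr, dotProduct, Finset.sum_mul_sum]
    congr 1
    exact Finset.sum_congr rfl fun i _ => Finset.sum_congr rfl fun j _ => by ring
  have hbb : ∀ k l, b k ⬝ᵥ b l = (u k ⬝ᵥ u l) + (v k ⬝ᵥ v l) := by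
    intro k l
    rw [hbω]
    simp [b]
  have huu : ∀ k, u k ⬝ᵥ u k = 1 := fun k => by
    rw [← hu k]; exact Finset.sum_congr rfl fun i _ => (sq _).symm
  have hvv : ∀ k, v k ⬝ᵥ v k = 1 := fun k => by
    rw [← hv k]; exact Finset.sum_congr rfl fun i _ => (sq _).symm
  have huv : ∀ k l, u k ⬝ᵥ u l ≤ 1 := fun k l => by
    simpa [hu] using dotProduct_le_sqrt_mul_sqrt (u k) (u l)
  have hvl : ∀ k l, v k ⬝ᵥ v l ≤ 1 := fun k l => by
    simpa [hv] using dotProduct_le_sqrt_mul_sqrt (v k) (v l)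
  have hcomp := gaussianPi_exists_ge_le a b
    (fun k l => by rw [haω]; simp [b]) (fun k => by rw [haa, hbb, huu, hvv]; norm_num)
    -- The covariance gap is `(1 - u k · u l)(1 - v k · v l) ≥ 0`.
    (fun k l => by rw [haa, hbb]; nlinarith [huv k l, hvl k l])
    -- Removing `γ` costs at most `1 + s/8 ≤ s/4`, which is where `8 ≤ s` enters. The remaining
    -- excess `3s/4 - 1` still covers the `s/8 + s/8` allowed to the two norms.
    (√p + √n + s - s / 4)
  rw [measureReal_def, measureReal_def,
    ENNReal.toReal_le_toReal (measure_ne_top _ _) (measure_ne_top _ _)] at hcomp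
  let Sγ : Finset (ComparisonIndex p n) := {Sum.inr (Sum.inl ())}
  let Sg : Finset (ComparisonIndex p n) := Finset.univ.map
    ⟨fun i : Fin p => Sum.inr (Sum.inr (Sum.inl i)), fun i j h => by simpa using h⟩
  let Sh : Finset (ComparisonIndex p n) := Finset.univ.map
    ⟨fun i : Fin n => Sum.inr (Sum.inr (Sum.inr i)), fun i j h => by simpa using h⟩
  have hs8 : 0 < s / 8 := by linarith
  have hγ := gaussianPi_sqrt_sum_sq_ge_le Sγ (by simp [Sγ]) hs8
  have hg := gaussianPi_sqrt_sum_sq_ge_le Sg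
    (by simpa [Sg] using (Finset.univ_nonempty_iff.2 ⟨(⟨0, hp⟩ : Fin p)⟩)) hs8
  have hh := gaussianPi_sqrt_sum_sq_ge_le Sh
    (by simpa [Sh] using (Finset.univ_nonempty_iff.2 ⟨(⟨0, hn⟩ : Fin n)⟩)) hs8
  simp only [Sγ, Finset.card_singleton, Finset.sum_singleton, Nat.cast_one, Real.sqrt_one,
    Real.sqrt_sq_eq_abs] at hγ
  simp only [Sg, Finset.card_map, Finset.card_univ, Fintype.card_fin, Finset.sum_map] at hg
  simp only [Sh, Finset.card_map, Finset.card_univ, Fintype.card_fin, Finset.sum_map] at hh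
  have hsplit : {ω : ComparisonIndex p n → ℝ |
        ∃ k, svThreshold p n s ≤ ∑ i, ∑ j, u k i * v k j * ω (Sum.inl (i, j))} ⊆
      {ω | ∃ k, √p + √n + s - s / 4 ≤ a k ⬝ᵥ ω} ∪
        {ω | 1 + s / 8 ≤ |ω (Sum.inr (Sum.inl ()))|} := by
    rintro ω ⟨k, hk⟩
    by_cases h : 1 + s / 8 ≤ |ω (Sum.inr (Sum.inl ()))|
    · exact Or.inr h
    · refine Or.inl ⟨k, ?_⟩
      rw [haω]
      unfold svThreshold at hk
      have := (abs_lt.1 (not_le.1 h)).1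
      linarith
  have hsplit' : {ω : ComparisonIndex p n → ℝ | ∃ k, √p + √n + s - s / 4 - 1 < b k ⬝ᵥ ω} ⊆
      {ω | √p + s / 8 ≤ √(∑ i : Fin p, ω (Sum.inr (Sum.inr (Sum.inl i))) ^ 2)} ∪
        {ω | √n + s / 8 ≤ √(∑ i : Fin n, ω (Sum.inr (Sum.inr (Sum.inr i))) ^ 2)} := by
    rintro ω ⟨k, hk⟩
    by_contra hcon
    simp only [Set.mem_union, Set.mem_ofPred_eq, not_or, not_le] at hcon
    have h1 := dotProduct_le_sqrt_mul_sqrt (u k) fun i => ω (Sum.inr (Sum.inr (Sum.inl i)))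
    have h2 := dotProduct_le_sqrt_mul_sqrt (v k) fun i => ω (Sum.inr (Sum.inr (Sum.inr i)))
    rw [hu, Real.sqrt_one, one_mul] at h1
    rw [hv, Real.sqrt_one, one_mul] at h2
    rw [hbω] at hk
    linarith [hcon.1, hcon.2]
  calc _ ≤ _ := measure_mono hsplit
    _ ≤ _ := measure_union_le _ _
    _ ≤ _ := add_le_add (hcomp.trans ((measure_mono hsplit').trans (measure_union_le _ _))) hγ
    _ ≤ _ := add_le_add (add_le_add hg hh) le_rfl
    _ = _ := by ring

variable {Ω : Type*} [MeasurableSpace Ω] {P : Measure Ω}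
  {E : Ω → Matrix (Fin p) (Fin n) ℝ}

theorem IsStdGaussianMatrix.aemeasurable (hE : IsStdGaussianMatrix E P) :
    AEMeasurable (fun ω (e : Fin p × Fin n) => E ω e.1 e.2) P :=
  aemeasurable_pi_iff.2 fun e => (hE.1 e.1 e.2).aemeasurable

theorem IsStdGaussianMatrix.map_eq (hE : IsStdGaussianMatrix E P) :
    P.map (fun ω (e : Fin p × Fin n) => E ω e.1 e.2) = gaussianPi (Fin p × Fin n) := by
  refine (iIndepFun.map_fun_eq_pi_map (f := fun (e : Fin p × Fin n) ω => E ω e.1 e.2)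
    (fun e => (hE.1 e.1 e.2).aemeasurable) hE.2).trans ?_
  congr 1
  ext1 e
  exact (hE.1 e.1 e.2).map_eq

theorem isStdGaussianMatrix_comparisonIndex :
    IsStdGaussianMatrix (fun (ω : ComparisonIndex p n → ℝ) => Matrix.of fun i j =>
      ω (Sum.inl (i, j))) (gaussianPi (ComparisonIndex p n)) := by
  refine ⟨fun i j => (measurePreserving_eval
    (fun _ : ComparisonIndex p n => gaussianReal 0 1) (Sum.inl (i, j))).hasLaw, ?_⟩
  have h := iIndepFun_pi (μ := fun _ : ComparisonIndex p n => gaussianReal 0 1)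
    (X := fun _ x => x) fun _ => aemeasurable_id
  exact h.precomp (g := fun e : Fin p × Fin n => Sum.inl e) Sum.inl_injective

/-- The event depends only on the joint law of the entries, so it may be evaluated in the model
space carrying the auxiliary variables. -/
theorem IsStdGaussianMatrix.measure_exists_ge_le (hE : IsStdGaussianMatrix E P)
    {κ : Type*} [Fintype κ] (hp : 0 < p) (hn : 0 < n)
    (u : κ → Fin p → ℝ) (v : κ → Fin n → ℝ) (hu : ∀ k, ∑ i, u k i ^ 2 = 1)
    (hv : ∀ k, ∑ j, v k j ^ 2 = 1) {s : ℝ} (hs : 8 ≤ s) :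
    P {ω | ∃ k, svThreshold p n s ≤ ∑ i, ∑ j, u k i * v k j * E ω i j} ≤
      3 * ENNReal.ofReal (Var[fun x => x ^ 2; gaussianReal 0 1] / (s / 8) ^ 2) := by
  let A : Set (Fin p × Fin n → ℝ) :=
    {y | ∃ k, svThreshold p n s ≤ ∑ i, ∑ j, u k i * v k j * y (i, j)}
  have hA : MeasurableSet A := by
    have : A = ⋃ k, {y | svThreshold p n s ≤ ∑ i, ∑ j, u k i * v k j * y (i, j)} := by
      ext; simp [A]
    rw [this]
    exact MeasurableSet.iUnion fun k => measurableSet_le measurable_const (by fun_prop)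
  have h1 := Measure.map_apply_of_aemeasurable hE.aemeasurable hA
  have hI := isStdGaussianMatrix_comparisonIndex (p := p) (n := n)
  have h2 := Measure.map_apply_of_aemeasurable hI.aemeasurable hA
  rw [hE.map_eq] at h1
  rw [hI.map_eq, h1] at h2
  exact h2.trans_le (gaussianPi_comparisonIndex_exists_ge_le hp hn u v hu hv hs)

/-- The operator norm of a Gaussian matrix exceeds `√p + √n + s` with probability `O(s⁻²)`. -/
theorem IsStdGaussianMatrix.measure_norm_gt_le (hE : IsStdGaussianMatrix E P)
    (hp : 0 < p) (hn : 0 < n) {s : ℝ} (hs : 8 ≤ s) :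
    P {ω | ∃ x, svThreshold p n s * ‖x‖ < ‖Matrix.toEuclideanLin (E ω) x‖} ≤
      3 * ENNReal.ofReal (Var[fun x => x ^ 2; gaussianReal 0 1] / (s / 8) ^ 2) := by
  let X := Metric.sphere (0 : EuclideanSpace ℝ (Fin p)) 1
  let Y := Metric.sphere (0 : EuclideanSpace ℝ (Fin n)) 1
  have : Nonempty X := ⟨EuclideanSpace.single ⟨0, hp⟩ 1, mem_sphere_zero_iff_norm.2 (by simp)⟩
  have : Nonempty Y := ⟨EuclideanSpace.single ⟨0, hn⟩ 1, mem_sphere_zero_iff_norm.2 (by simp)⟩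
  -- Slepian's inequality handles finite families. The bound does not depend on their size, so it
  -- passes to the increasing union along a dense sequence.
  let q : ℕ → X × Y := TopologicalSpace.denseSeq (X × Y)
  have hT : 0 ≤ svThreshold p n s := by unfold svThreshold; positivity
  let A : ℕ → Set Ω := fun N => {ω | ∃ k : Fin N, svThreshold p n s ≤
    ∑ i, ∑ j, (q k).1.1 i * (q k).2.1 j * E ω i j}
  have hmono : Monotone A := fun N M h ω ⟨k, hk⟩ => ⟨Fin.castLE h k, hk⟩
  have hinner : ∀ ω (x : X) (y : Y), inner ℝ x.1 (Matrix.toEuclideanLin (E ω) y.1) =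
      ∑ i, ∑ j, x.1 i * y.1 j * E ω i j := by
    intro ω x y
    simp only [PiLp.inner_apply, Matrix.toLpLin_apply, Matrix.mulVec, dotProduct,
      RCLike.inner_apply, conj_trivial, Finset.sum_mul]
    exact Finset.sum_congr rfl fun i _ => Finset.sum_congr rfl fun j _ => by ring
  have hsub : {ω | ∃ x, svThreshold p n s * ‖x‖ < ‖Matrix.toEuclideanLin (E ω) x‖} ⊆
      ⋃ N, A N := by
    rintro ω ⟨x, hx⟩
    set T := Matrix.toEuclideanLin (E ω)
    have hTx : 0 < ‖T x‖ := lt_of_le_of_lt (by positivity) hx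
    have hx0 : 0 < ‖x‖ := norm_pos_iff.2 fun h => by simp [h] at hTx
    -- Strict excess is an open condition, so a term of the dense sequence witnesses it.
    have hopen : IsOpen {w : X × Y | svThreshold p n s < inner ℝ w.1.1 (T w.2.1)} := by
      have hc : Continuous T := T.continuous_of_finiteDimensional
      exact isOpen_lt continuous_const (by fun_prop)
    have hne : {w : X × Y | svThreshold p n s < inner ℝ w.1.1 (T w.2.1)}.Nonempty := by
      refine ⟨(⟨(‖T x‖)⁻¹ • T x, ?_⟩, ⟨(‖x‖)⁻¹ • x, ?_⟩), ?_⟩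
      · exact mem_sphere_zero_iff_norm.2 (by simp [norm_smul, hTx.ne'])
      · exact mem_sphere_zero_iff_norm.2 (by simp [norm_smul, hx0.ne'])
      · simp only [Set.mem_ofPred_eq, map_smul, real_inner_smul_left, real_inner_smul_right,
          real_inner_self_eq_norm_sq]
        rw [lt_inv_mul_iff₀ hx0, lt_inv_mul_iff₀ hTx]
        nlinarith
    obtain ⟨w, hw, k, rfl⟩ := (TopologicalSpace.denseRange_denseSeq (X × Y)).inter_open_nonempty
      _ hopen hne
    refine Set.mem_iUnion.2 ⟨k + 1, ⟨k, Nat.lt_succ_self k⟩, ?_⟩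
    rw [← hinner]
    exact le_of_lt hw
  have hnorm : ∀ {m : ℕ} (x : Metric.sphere (0 : EuclideanSpace ℝ (Fin m)) 1),
      ∑ i, x.1 i ^ 2 = 1 := fun x => by
    rw [← EuclideanSpace.real_norm_sq_eq]; simp
  refine (measure_mono hsub).trans ?_
  rw [hmono.measure_iUnion]
  exact iSup_le fun N => hE.measure_exists_ge_le hp hn (fun k : Fin N => (q k).1.1)
    (fun k => (q k).2.1) (fun k => hnorm _) (fun k => hnorm _) hs

end GaussianMatrix

/-! ### Size of the threshold and conclusion. -/

/-- The collinearity threshold beyond which the signal exceeds twice the level `√p + √n + s`. -/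
noncomputable def collinearityThreshold (Δ : ℝ) (p n : ℕ) (s : ℝ) : ℝ :=
  1 + 2 / Δ * ((2 * svThreshold p n s + 1) / √n)

theorem exists_collinearityThreshold_le {Δ : ℝ} (hΔ : 0 < Δ) {p : ℕ → ℕ} {s : ℕ → ℝ}
    (hs : s =o[atTop] fun n : ℕ => √(p n : ℝ) + √(n : ℝ))
    (hp : (fun n : ℕ => (p n : ℝ)) =O[atTop] fun n : ℕ => (n : ℝ)) :
    ∃ t₀ : ℝ, ∀ n, collinearityThreshold Δ (p n) n (s n) ≤ t₀ := by
  obtain ⟨C, hC0, hC⟩ := hp.exists_pos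
  have hbdd : IsBoundedUnder (· ≤ ·) atTop
      fun n => collinearityThreshold Δ (p n) n (s n) := by
    -- Eventually `s ≤ √p + √n` and `√p ≤ √C √n`, so the level is at most `2(√C + 1)√n`; the final
    -- `1` uses `1 ≤ √n`.
    refine ⟨1 + 2 / Δ * (4 * (√C + 1) + 1), ?_⟩
    rw [eventually_map]
    filter_upwards [hC.bound, hs.bound one_pos, eventually_ge_atTop 1] with n h1 h2 hn
    have hn' : (1 : ℝ) ≤ n := by exact_mod_cast hn
    have hn1 : 1 ≤ √(n : ℝ) := Real.one_le_sqrt.2 hn'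
    rw [Real.norm_natCast, Real.norm_natCast] at h1
    have h3 : √(p n : ℝ) ≤ √C * √n := by
      rw [← Real.sqrt_mul hC0.le]
      exact Real.sqrt_le_sqrt h1
    rw [one_mul, Real.norm_eq_abs, Real.norm_of_nonneg (by positivity)] at h2
    have h4 := (le_abs_self _).trans h2
    unfold collinearityThreshold svThreshold
    gcongr
    rw [div_le_iff₀ (by linarith)]
    nlinarith
  obtain ⟨t₀, ht₀⟩ := hbdd.bddAbove_range
  exact ⟨t₀, fun n => ht₀ ⟨n, rfl⟩⟩

theorem two_mul_svThreshold_lt {Δ t s : ℝ} (hΔ : 0 < Δ) {p n : ℕ} (hn : 0 < n)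
    (ht : collinearityThreshold Δ p n s ≤ t) :
    2 * svThreshold p n s < Δ / 2 * ((t - 1) * √n) := by
  have hn' : 0 < √(n : ℝ) := Real.sqrt_pos.2 (by exact_mod_cast hn)
  unfold collinearityThreshold at ht
  -- The `+ 1` in the threshold supplies the strict inequality.
  calc 2 * svThreshold p n s < 2 * svThreshold p n s + 1 := lt_add_one _
    _ = Δ / 2 * (2 / Δ * ((2 * svThreshold p n s + 1) / √n) * √n) := by field_simp
    _ ≤ _ := by gcongr; linarith

theorem tendsto_measure_norm_gt {p : ℕ → ℕ} (hp : ∀ n, 2 ≤ n → 2 ≤ p n) {s : ℕ → ℝ}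
    (hs : Tendsto s atTop atTop) {Ω : ℕ → Type*} [∀ n, MeasurableSpace (Ω n)]
    {P : ∀ n, Measure (Ω n)} [∀ n, IsProbabilityMeasure (P n)]
    {E : ∀ n, Ω n → Matrix (Fin (p n)) (Fin n) ℝ} (hE : ∀ n, IsStdGaussianMatrix (E n) (P n)) :
    Tendsto (fun n => P n {ω | ∃ x, svThreshold (p n) n (s n) * ‖x‖ <
      ‖Matrix.toEuclideanLin (E n ω) x‖}) atTop (𝓝 0) := by
  have hlim : Tendsto (fun n => 3 * ENNReal.ofReal
      (Var[fun x => x ^ 2; gaussianReal 0 1] / (s n / 8) ^ 2)) atTop (𝓝 0) := by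
    have h1 : Tendsto (fun n => (s n / 8) ^ 2) atTop atTop :=
      (tendsto_pow_atTop two_ne_zero).comp (hs.atTop_div_const (by norm_num))
    have h2 := ENNReal.tendsto_ofReal
      ((tendsto_const_nhds (x := Var[fun x => x ^ 2; gaussianReal 0 1])).div_atTop h1)
    simpa using ENNReal.Tendsto.const_mul (a := 3) h2 (Or.inr (by simp))
  refine tendsto_of_tendsto_of_tendsto_of_le_of_le' tendsto_const_nhds hlim
    (Eventually.of_forall fun n => zero_le) ?_
  filter_upwards [eventually_ge_atTop 2, hs.eventually_ge_atTop 8] with n hn hs8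
  exact (hE n).measure_norm_gt_le (by have := hp n hn; omega) (by omega) hs8

theorem lemma2 (Δ : ℝ) (hΔ : 0 < Δ)
    (p : ℕ → ℕ) (hp : ∀ n, 2 ≤ n → 2 ≤ p n)
    (s : ℕ → ℝ) (hs : Tendsto s atTop atTop)
    (hs' : s =o[atTop] fun n : ℕ => √(p n : ℝ) + √(n : ℝ)) :
    ∃ τ : ℕ → ℝ,
      (((fun n : ℕ => (p n : ℝ)) =O[atTop] fun n : ℕ => (n : ℝ)) → ∃ t₀ : ℝ, ∀ n, τ n ≤ t₀) ∧
      ∀ t : ℕ → ℝ, (∀ᶠ n in atTop, τ n ≤ t n) →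
      ∀ v : ∀ n, EuclideanSpace ℝ (Fin (p n)), (∀ n, 2 ≤ n → ‖v n‖ = Δ / 2) →
      ∀ z : ∀ n, Fin n → Fin 2, (∀ n, 2 ≤ n → Function.Surjective (z n)) →
      ∀ (Ω : ℕ → Type*) [∀ n, MeasurableSpace (Ω n)] (P : ∀ n, Measure (Ω n))
        [∀ n, IsProbabilityMeasure (P n)]
        (E : ∀ n, Ω n → Matrix (Fin (p n)) (Fin n) ℝ),
        (∀ n, IsStdGaussianMatrix (E n) (P n)) →
        (∀ n, 2 ≤ n → ‖collinearCentres (t n) (v n) 0 - collinearCentres (t n) (v n) 1‖ = Δ) ∧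
        Tendsto (fun n => P n {ω | rawEstimator (svThreshold (p n) n (s n))
          (signalMatrix (collinearCentres (t n) (v n)) (z n) + E n ω) = 1}) atTop (𝓝 1) ∧
        ¬ IsConsistentFor P (fun n ω => rawEstimator (svThreshold (p n) n (s n))
          (signalMatrix (collinearCentres (t n) (v n)) (z n) + E n ω)) 2 := by
  refine ⟨fun n => collinearityThreshold Δ (p n) n (s n),
    exists_collinearityThreshold_le hΔ hs', ?_⟩
  intro t ht v hv z _ Ω _ P _ E hE
  set K : ∀ n, Ω n → ℕ := fun n ω => rawEstimator (svThreshold (p n) n (s n))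
    (signalMatrix (collinearCentres (t n) (v n)) (z n) + E n ω)
  have hbad := tendsto_measure_norm_gt hp hs hE
  have hsub : ∀ᶠ n in atTop, {ω | K n ω = 1}ᶜ ⊆ {ω | ∃ x, svThreshold (p n) n (s n) * ‖x‖ <
      ‖Matrix.toEuclideanLin (E n ω) x‖} := by
    filter_upwards [ht, eventually_ge_atTop 2, hs.eventually_ge_atTop 0] with n htn hn hsn ω hω
    by_contra hN
    have hN' : ∀ x, ‖Matrix.toEuclideanLin (E n ω) x‖ ≤ svThreshold (p n) n (s n) * ‖x‖ :=
      fun x => not_lt.1 fun h => hN ⟨x, h⟩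
    have hT : 0 ≤ svThreshold (p n) n (s n) := by unfold svThreshold; positivity
    have ht1 : 1 ≤ t n := by
      refine le_trans ?_ htn
      unfold collinearityThreshold
      exact le_add_of_nonneg_right (by positivity)
    refine hω (rawEstimator_signal_add_noise_eq_one (hp n hn) hn hT ht1 (v n) (z n) ?_ hN')
    rw [hv n hn]
    exact two_mul_svThreshold_lt hΔ (by omega) htn
  have hcompl : Tendsto (fun n => P n {ω | K n ω = 1}ᶜ) atTop (𝓝 0) :=
    tendsto_of_tendsto_of_tendsto_of_le_of_le' tendsto_const_nhds hbad
      (Eventually.of_forall fun n => zero_le) (hsub.mono fun n h => measure_mono h)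
  refine ⟨fun n hn => ?_, ?_, fun hcons => ?_⟩
  · have : collinearCentres (t n) (v n) 0 - collinearCentres (t n) (v n) 1 = (2 : ℝ) • v n := by
      simp only [collinearCentres, Matrix.cons_val_zero, Matrix.cons_val_one]
      module
    rw [this, norm_smul, hv n hn, Real.norm_of_nonneg zero_le_two]
    ring
  · refine tendsto_of_tendsto_of_tendsto_of_le_of_le
      (g := fun n => 1 - P n {ω | K n ω = 1}ᶜ) ?_ tendsto_const_nhds (fun n => ?_)
      fun n => prob_le_one
    · simpa using ENNReal.Tendsto.sub (tendsto_const_nhds (x := (1 : ENNReal))) hcompl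
        (Or.inl ENNReal.one_ne_top)
    -- Subadditivity gives the lower bound without measurability of the event.
    · refine tsub_le_iff_right.2 ?_
      rw [← measure_univ (μ := P n), ← Set.union_compl_self {ω | K n ω = 1}]
      exact measure_union_le _ _
  · have h2 : Tendsto (fun n => P n {ω | K n ω = 2}) atTop (𝓝 0) :=
      tendsto_of_tendsto_of_tendsto_of_le_of_le tendsto_const_nhds hcompl
        (fun n => zero_le) fun n => measure_mono fun ω (hω : K n ω = 2) (h : K n ω = 1) => by
          omega
    exact zero_ne_one (tendsto_nhds_unique h2 hcons)
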